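/- \textbf{Setting.} Let $\mathbb F$ be a finite field with $q$ elements, let $r_1,r_2\ge 1$ satisfy $\gcd(q,r_1r_2)=1$, let $\mathbb L\supseteq\mathbb F$ be an extension field, and let $\alpha_i\in\mathbb L$ be a primitive $r_i$-th root of unity ($i=1,2$). Put $\mathcal I=\{0,\dots,r_1-1\}\times\{0,\dots,r_2-1\}$. Let $e=\sum_{m\in\mathcal I}e_mX^m\in\mathbb F[X_1,X_2]$, let $\omega(e)$ be the number of its nonzero coefficients, and let $t$ be an integer with $\omega(e)\le t\le\lfloor r_i/2\rfloor$ for $i=1,2$. For $\tau\in\mathcal I$ let $U=(u_n)_{n\in\mathbb N^2}$, $u_n=e(\alpha_1^{\tau_1+n_1},\alpha_2^{\tau_2+n_2})$, be the syndrome table afforded by $\tau$ and $e$. Write $\preceq$ for the componentwise order on $\mathbb N^2$. Let $\le_T$ be one of the following two orders on $\mathbb N^2$. Either it is the lexicographic order with $X_1>X_2$, with successor $l+1=(l_1,l_2+1)$ if $l_2<r_2-1$ and $(l_1+1,0)$ otherwise, and then assume $u_{(0,j)}\ne0$ for some $j<t$ (the l-condition). Or it is the graded order with $X_2>X_1$,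 with successor $l+1=(l_1-1,l_2+1)$ if $l_1>0$ and $(l_2+1,0)$ if $l_1=0$, and then assume $u_{(i,j)}\neq 0$ for some $(i,j)$ with $i+j=1$ (the g-condition). Let $LP(f)$ be the $\le_T$-largest exponent of $f\in\mathbb L[X_1,X_2]\setminus\{0\}$. Put $f[U]_n=\sum_{m}f_m\,u_{m+n-LP(f)}$ if $LP(f)\preceq n$, and $f[U]_n=0$ otherwise. Let $\Lambda(u^l)$ be the set of $f$ with $f[U]_k=0$ for all $k\in\mathcal I$ with $k<_Tl$ and $LP(f)\preceq k$. For a set $F$ of nonzero polynomials let $\Delta(F)=\{n : LP(f)\not\preceq n\text{ for all }f\in F\}$. A finite set $F=\{f^{(1)},\dots,f^{(d)}\}\subset\Lambda(u^l)$ of nonzero polynomials, with $s^{(i)}=LP(f^{(i)})$, is a \emph{minimal set of polynomials for $u^l$} if $s^{(1)}_1>\dots>s^{(d)}_1=0$, $0=s^{(1)}_2<\dots<s^{(d)}_2$, and no nonzero $g$ with $LP(g)\in\Delta(F)$ lies in $\Lambda(u^l)$. \textbf{The algorithm.} The Berlekamp--Massey--Sakata algorithm (BMSa) starts at $(0,0)$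 with $F_{(0,0)}=\{1\}$, $G_{(0,0)}=\emptyset$, and visits the indices along the successor function. At $l$, let $N$ be the set of $f\in F_l$ with $f[U]_l\ne0$. If $N=\emptyset$, put $F_{l+1}=F_l$ and $G_{l+1}=G_l$. Otherwise let $\Delta'=\Delta(F_l)\cup\bigcup_{f\in N}\{n: n\preceq l-LP(f)\}$. Then $F_{l+1}$ contains exactly one polynomial $h$ with $LP(h)=s$ for each $\preceq$-minimal point $s$ of $\mathbb N^2\setminus\Delta'$, and no others; it is one of the following: \begin{itemize} \item an element $h$ of $F_l\setminus N$ with $LP(h)=s$; \item $X^{s-LP(f)}f-\frac{f[U]_l}{g[U]_k}X^{s+c-l}g$ with $f\in N$, $(g,k)\in G_l$, $c=k-LP(g)$ and $s=\bigl(\max(LP(f)_i,\,l_i-c_i)\bigr)_{i=1,2}$; \item $X^{s-LP(f)}f$ with $f\in N$, $LP(f)\preceq s$, if $s\not\preceq l$. \end{itemize} $G_{l+1}$ contains exactly one pair $(g,k)$ with $k-LP(g)=c$ for each $\preceq$-maximal point $c$ of $\Delta'$, and no others; it is an element of $G_l$ or, if $c\notin\Delta(F_l)$, a pair $(f,l)$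 with $f\in N$. The steps at indices outside $$\mathcal S(t)=\{n\in\mathcal I: n_1=0,\ n_2<2t\}\cup\{n\in\mathcal I: n_2=0,\ n_1<2t\}\cup\{n\in\mathcal I: n_1,n_2\ne0,\ n_1+n_2\le t\}$$ may be skipped (so that $F_{l+1}=F_l$ and $G_{l+1}=G_l$). \textbf{Theorem.} Let $l=(l_1,l_2)$ with $l_1+l_2=t$ and $l_1,l_2>1$. Let $F_l$ be the set of polynomials with which the BMSa, run on $U$, arrives at the index $l$ (before the step $l$, so that $u_l$ has not been used), or, more generally, any minimal set of polynomials for $u^l$. Then there is $f\in F_l$ with $s=LP(f)\preceq l$ and $f[U]_l=0$. Consequently the value $u_l$ is given by this linear recurring relation: $$u_l=-\frac1{f_{s}}\sum_{m\in\mathrm{supp}(f),\,m\ne s}f_m\,u_{m+l-s},\qquad f_s\neq 0,$$ where all the indices $m+l-s$ occurring on the right are $<_Tl$. -/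

import Mathlib

open MvPolynomial
open scoped MonomialOrder

namespace BMS

/-! ### Indices and monomial orders

Exponents and array indices are elements of `Fin 2 →₀ ℕ`: coordinate `0` belongs to `X₁` and
coordinate `1` to `X₂`.  The partial order `⪯` is the componentwise order `≤` of `Fin 2 →₀ ℕ`. -/

/-- The pair `(a, b)`. -/
noncomputable def pt (a b : ℕ) : Fin 2 →₀ ℕ := Finsupp.single 0 a + Finsupp.single 1 b

@[simp] theorem pt_zero (a b : ℕ) : pt a b 0 = a := by simp [pt]

@[simp] theorem pt_one (a b : ℕ) : pt a b 1 = b := by simp [pt]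

/-- The graded order with `X₂ > X₁`: compare total degrees first, then the exponents of `X₂`.
It is the degree-lexicographic order for the reversed list of variables. -/
noncomputable def gradedOrder : MonomialOrder (Fin 2) where
  syn := (MonomialOrder.degLex (σ := (Fin 2)ᵒᵈ)).syn
  toSyn := (Finsupp.domCongr OrderDual.toDual).trans (MonomialOrder.degLex (σ := (Fin 2)ᵒᵈ)).toSyn
  toSyn_monotone := by
    intro a b h
    apply (MonomialOrder.degLex (σ := (Fin 2)ᵒᵈ)).toSyn_monotone
    intro i
    exact h (OrderDual.ofDual i)

/-- The two orderings under which the algorithm is run. -/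
inductive Ordering2 where
  | lex
  | graded

/-- `≤_T`: the lexicographic order with `X₁ > X₂`, or the graded order with `X₂ > X₁`. -/
noncomputable def Ordering2.toMonomialOrder : Ordering2 → MonomialOrder (Fin 2)
  | .lex => MonomialOrder.lex
  | .graded => gradedOrder

theorem lex_lt_iff (a b : Fin 2 →₀ ℕ) :
    (a ≺[Ordering2.lex.toMonomialOrder] b) ↔ a 0 < b 0 ∨ (a 0 = b 0 ∧ a 1 < b 1) := by
  change toLex a < toLex b ↔ _
  rw [Finsupp.Lex.lt_iff]
  simp [Fin.exists_fin_two, Fin.forall_fin_two]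

theorem graded_lt_iff (a b : Fin 2 →₀ ℕ) :
    (a ≺[Ordering2.graded.toMonomialOrder] b) ↔
      a 0 + a 1 < b 0 + b 1 ∨ (a 0 + a 1 = b 0 + b 1 ∧ a 1 < b 1) := by
  change toDegLex (Finsupp.domCongr OrderDual.toDual a) <
    toDegLex (Finsupp.domCongr OrderDual.toDual b) ↔ _
  have hdeg (c : Fin 2 →₀ ℕ) :
      Finsupp.degree (Finsupp.domCongr (OrderDual.toDual (α := Fin 2)) c) = c 0 + c 1 := by
    rw [Finsupp.degree_eq_sum]
    exact (Fin.sum_univ_two fun i => c i)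
  rw [Finsupp.DegLex.lt_iff]
  simp only [ofDegLex_toDegLex, hdeg, Finsupp.Lex.lt_iff]
  refine or_congr_right (and_congr_right fun h => ?_)
  change (∃ j : Fin 2, (∀ k : Fin 2, j < k → a k = b k) ∧ a j < b j) ↔ _
  simp only [Fin.exists_fin_two, Fin.forall_fin_two]
  simp
  omega

/-- The successor `l + 1` of an index, for arrays of period `r 0 × r 1`. -/
noncomputable def Ordering2.next (r : Fin 2 → ℕ) : Ordering2 → (Fin 2 →₀ ℕ) → (Fin 2 →₀ ℕ)
  | .lex, l => if l 1 < r 1 - 1 then pt (l 0) (l 1 + 1) else pt (l 0 + 1) 0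
  | .graded, l => if 0 < l 0 then pt (l 0 - 1) (l 1 + 1) else pt (l 1 + 1) 0

/-- The index set `𝓘 = ℤ_{r₁} × ℤ_{r₂}` (canonical representatives). -/
def box (r : Fin 2 → ℕ) : Set (Fin 2 →₀ ℕ) := {n | ∀ i, n i < r i}

/-- The index set `𝓢(t)`. -/
def searchSet (r : Fin 2 → ℕ) (t : ℕ) : Set (Fin 2 →₀ ℕ) :=
  {n | n ∈ box r ∧
    ((n 0 = 0 ∧ n 1 < 2 * t) ∨ (n 1 = 0 ∧ n 0 < 2 * t) ∨
      (n 0 ≠ 0 ∧ n 1 ≠ 0 ∧ n 0 + n 1 ≤ t))}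

section Arrays

variable {L : Type*} [Field L]

/-- The l-condition (for the lexicographic order), resp. the g-condition (for the graded order)
on `𝓢(t)`. -/
def Ordering2.Condition (U : (Fin 2 →₀ ℕ) → L) (t : ℕ) : Ordering2 → Prop
  | .lex => ∃ j, j < t ∧ U (pt 0 j) ≠ 0
  | .graded => ∃ i j, i + j = 1 ∧ U (pt i j) ≠ 0

/-- The syndrome table afforded by `τ` and `e`: `u_n = e(α₁ ^ (τ₁ + n₁), α₂ ^ (τ₂ + n₂))`. -/
noncomputable def syndromeTable {K : Type*} [Field K] [Algebra K L]
    (α : Fin 2 → L) (τ : Fin 2 →₀ ℕ) (e : MvPolynomial (Fin 2) K) : (Fin 2 →₀ ℕ) → L :=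
  fun n => aeval (fun i => α i ^ (τ i + n i)) e

/-- The leading power product exponent (multidegree) of `f`. -/
noncomputable def LP (T : Ordering2) (f : MvPolynomial (Fin 2) L) : Fin 2 →₀ ℕ :=
  T.toMonomialOrder.degree f

open Classical in
/-- `f[U]_n`; the value is `0` by convention when `LP f ⪯ n` fails. -/
noncomputable def recur (T : Ordering2) (U : (Fin 2 →₀ ℕ) → L) (f : MvPolynomial (Fin 2) L)
    (n : Fin 2 →₀ ℕ) : L :=
  if LP T f ≤ n then ∑ m ∈ f.support, f.coeff m * U (m + n - LP T f) else 0

/-- `Λ(u^l)`: the polynomials with `f[U]_k = 0` at every index `k` of the subarray `u^l`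
(that is, `k ∈ 𝓘` and `k <_T l`) with `LP f ⪯ k`. -/
def generating (T : Ordering2) (r : Fin 2 → ℕ) (U : (Fin 2 →₀ ℕ) → L) (l : Fin 2 →₀ ℕ) :
    Set (MvPolynomial (Fin 2) L) :=
  {f | ∀ k ∈ box r, (k ≺[T.toMonomialOrder] l) → LP T f ≤ k → recur T U f k = 0}

/-- The footprint `Δ(F)`: the indices that no leading exponent of `F` divides. For a staircase of
leading exponents it is the union of the rectangles spanned by consecutive leading exponents, see
`footprint_range_eq`. -/
def footprint (T : Ordering2) (F : Set (MvPolynomial (Fin 2) L)) : Set (Fin 2 →₀ ℕ) :=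
  {n | ∀ f ∈ F, ¬ LP T f ≤ n}

/-- The leading exponents `s⁽¹⁾, …, s⁽ᵈ⁾` of the sequence `f` (`d ≥ 1`) satisfy
`s⁽¹⁾₁ > ⋯ > s⁽ᵈ⁾₁ = 0` and `0 = s⁽¹⁾₂ < ⋯ < s⁽ᵈ⁾₂`. -/
def IsStaircase (T : Ordering2) {d : ℕ} (f : Fin (d + 1) → MvPolynomial (Fin 2) L) : Prop :=
  StrictAnti (fun i => LP T (f i) 0) ∧ LP T (f (Fin.last d)) 0 = 0 ∧
    StrictMono (fun i => LP T (f i) 1) ∧ LP T (f 0) 1 = 0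

theorem footprint_range_eq (T : Ordering2) {d : ℕ} (f : Fin (d + 1) → MvPolynomial (Fin 2) L)
    (hf : IsStaircase T f) :
    footprint T (Set.range f) =
      {n | ∃ i : Fin d, n 0 < LP T (f i.castSucc) 0 ∧ n 1 < LP T (f i.succ) 1} := by
  obtain ⟨h1, h2, h3, h4⟩ := hf
  ext n
  simp only [footprint, Set.mem_ofPred_eq, Set.forall_mem_range, Finsupp.le_def,
    Fin.forall_fin_two, not_and, not_le]
  constructor
  · intro h
    by_contra! hc
    have key : ∀ i : Fin (d + 1), LP T (f i) 1 ≤ n 1 := by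
      intro i
      induction i using Fin.induction with
      | zero => omega
      | succ i ih =>
        by_contra hlt
        have h5 := hc i
        have h6 := h i.castSucc
        by_cases h7 : n 0 < LP T (f i.castSucc) 0
        · exact hlt (h5 h7)
        · exact absurd (h6 (by omega)) (by omega)
    exact absurd (h (Fin.last d) (by omega)) (by have := key (Fin.last d); omega)
  · rintro ⟨i, hi1, hi2⟩ j hj
    rcases le_or_gt j i.castSucc with hji | hji
    · have : LP T (f i.castSucc) 0 ≤ LP T (f j) 0 := h1.antitone hji
      omega
    · have : LP T (f i.succ) 1 ≤ LP T (f j) 1 :=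
        h3.monotone (Fin.castSucc_lt_iff_succ_le.mp hji)
      omega

/-- `F` is a minimal set of polynomials for `u^l`. -/
def IsMinimalSet (T : Ordering2) (r : Fin 2 → ℕ) (U : (Fin 2 →₀ ℕ) → L) (l : Fin 2 →₀ ℕ)
    (F : Set (MvPolynomial (Fin 2) L)) : Prop :=
  (∃ (d : ℕ) (f : Fin (d + 1) → MvPolynomial (Fin 2) L), F = Set.range f ∧
    (∀ i, f i ≠ 0 ∧ f i ∈ generating T r U l) ∧ IsStaircase T f) ∧
  ∀ g : MvPolynomial (Fin 2) L, g ≠ 0 → LP T g ∈ footprint T F → g ∉ generating T r U l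

/-! ### The Berlekamp–Massey–Sakata algorithm

A state of the algorithm consists of the set `F` of current polynomials and of the set `G` of
auxiliary pairs `(g, k)`, where `g` failed at the earlier step `k`. -/

/-- The index `k - LP g` attached to an auxiliary pair `(g, k)`. -/
noncomputable def span (T : Ordering2) (p : MvPolynomial (Fin 2) L × (Fin 2 →₀ ℕ)) : Fin 2 →₀ ℕ :=
  p.2 - LP T p.1

/-- The members of `F` with `f[U]_l ≠ 0`; by the convention in `recur` they have `LP f ⪯ l`. -/
def failing (T : Ordering2) (U : (Fin 2 →₀ ℕ) → L) (l : Fin 2 →₀ ℕ)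
    (F : Set (MvPolynomial (Fin 2) L)) : Set (MvPolynomial (Fin 2) L) :=
  {f | f ∈ F ∧ recur T U f l ≠ 0}

/-- The updated footprint: the old one together with all indices below `l - LP f`, for the
failing `f`. (Nothing is added by those `f` for which `l - LP f` is already in `Δ(F)`.) -/
def newFootprint (T : Ordering2) (U : (Fin 2 →₀ ℕ) → L) (l : Fin 2 →₀ ℕ)
    (F : Set (MvPolynomial (Fin 2) L)) : Set (Fin 2 →₀ ℕ) :=
  footprint T F ∪ {n | ∃ f ∈ failing T U l F, n ≤ l - LP T f}

/-- The Berlekamp combination of `f`, failing at `l`, and `(g, k)`, with leading exponent `s`: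
`X^(s - LP f) f - (f[U]_l / g[U]_k) X^(s - l + k - LP g) g`. -/
noncomputable def berlekamp (T : Ordering2) (U : (Fin 2 →₀ ℕ) → L) (l s : Fin 2 →₀ ℕ)
    (f : MvPolynomial (Fin 2) L) (p : MvPolynomial (Fin 2) L × (Fin 2 →₀ ℕ)) :
    MvPolynomial (Fin 2) L :=
  monomial (s - LP T f) 1 * f -
    monomial (s + span T p - l) (recur T U f l / recur T U p.1 p.2) * p.1

/-- `h` is an admissible new polynomial for the defining point `s` of the new footprint:
either a member of `F` that did not fail; or the Berlekamp combination of a failing `f` and an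
auxiliary pair, where `s` is the componentwise maximum of `LP f` and `l - span p`; or, if
`s ⪯ l` does not hold, a shift of a failing polynomial. -/
def IsNewPoly (T : Ordering2) (U : (Fin 2 →₀ ℕ) → L) (l : Fin 2 →₀ ℕ)
    (F : Set (MvPolynomial (Fin 2) L)) (G : Set (MvPolynomial (Fin 2) L × (Fin 2 →₀ ℕ)))
    (s : Fin 2 →₀ ℕ) (h : MvPolynomial (Fin 2) L) : Prop :=
  (h ∈ F ∧ recur T U h l = 0 ∧ LP T h = s) ∨
  (∃ f ∈ failing T U l F, ∃ p ∈ G, s = LP T f ⊔ (l - span T p) ∧ h = berlekamp T U l s f p) ∨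
  (∃ f ∈ failing T U l F, LP T f ≤ s ∧ ¬ s ≤ l ∧ h = monomial (s - LP T f) 1 * f)

/-- One step of the algorithm at the index `l`, from `(F_l, G_l)` to `(F_{l+1}, G_{l+1})`. If no
polynomial fails, nothing changes. Otherwise there is one new polynomial for every defining point
(minimal index outside) of the new footprint, and one auxiliary pair for every corner point (maximal
index inside); an auxiliary pair is kept while its corner persists, and the new corners are those
`l - LP f` of failing `f`. -/
def IsStep (T : Ordering2) (U : (Fin 2 →₀ ℕ) → L) (l : Fin 2 →₀ ℕ)
    (F : Set (MvPolynomial (Fin 2) L)) (G : Set (MvPolynomial (Fin 2) L × (Fin 2 →₀ ℕ)))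
    (F' : Set (MvPolynomial (Fin 2) L)) (G' : Set (MvPolynomial (Fin 2) L × (Fin 2 →₀ ℕ))) :
    Prop :=
  (failing T U l F = ∅ ∧ F' = F ∧ G' = G) ∨
  ((failing T U l F).Nonempty ∧
    (∀ h ∈ F', Minimal (· ∉ newFootprint T U l F) (LP T h) ∧ IsNewPoly T U l F G (LP T h) h) ∧
    (∀ s, Minimal (· ∉ newFootprint T U l F) s → ∃! h, h ∈ F' ∧ LP T h = s) ∧
    (∀ p ∈ G', Maximal (· ∈ newFootprint T U l F) (span T p) ∧
      (p ∈ G ∨ (span T p ∉ footprint T F ∧ p.1 ∈ failing T U l F ∧ p.2 = l))) ∧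
    (∀ c, Maximal (· ∈ newFootprint T U l F) c → ∃! p, p ∈ G' ∧ span T p = c))

/-- `BMSRun T r U t l F G`: a run of the algorithm, started at `(0,0)` with `F = {1}` and `G = ∅`,
has reached the index `l` with `F_l = F` and `G_l = G`. The indices are visited along the successor
function; those outside `𝓢(t)` may be skipped, so that the run over the whole of `𝓘` and
the run over `𝓢(t)` only are both covered. -/
inductive BMSRun (T : Ordering2) (r : Fin 2 → ℕ) (U : (Fin 2 →₀ ℕ) → L) (t : ℕ) :
    (Fin 2 →₀ ℕ) → Set (MvPolynomial (Fin 2) L) →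
      Set (MvPolynomial (Fin 2) L × (Fin 2 →₀ ℕ)) → Prop
  | init : BMSRun T r U t 0 {1} ∅
  | step {l : Fin 2 →₀ ℕ} {F F' : Set (MvPolynomial (Fin 2) L)}
      {G G' : Set (MvPolynomial (Fin 2) L × (Fin 2 →₀ ℕ))} :
      BMSRun T r U t l F G → IsStep T U l F G F' G' → BMSRun T r U t (T.next r l) F' G'
  | skip {l : Fin 2 →₀ ℕ} {F : Set (MvPolynomial (Fin 2) L)}
      {G : Set (MvPolynomial (Fin 2) L × (Fin 2 →₀ ℕ))} :
      BMSRun T r U t l F G → l ∉ searchSet r t → BMSRun T r U t (T.next r l) F G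

end Arrays

end BMS

/-!
The syndrome table is a sum of exponentials `U n = ∑ j, c_j x_j ^ n` with at most `t` terms, one for
each nonzero coefficient of `e`. The polynomials that are valid recurrences on the whole table include
the vanishing ideal of the points `x_j`, so the footprint `footprintAll` of the valid polynomials has
at most `t` points (`card_le_of_subset_footprintAll`). Two facts link this footprint with the partial
recurrences that the algorithm computes. The footprint of `F_l` is contained in it; and if a
polynomial `f` which is valid before `l` fails at `l`, then the whole rectangle below `l - LP f` is
contained in it (`Iic_subset_footprintAll`, by computing the correlation of `f * g` in two ways).

Suppose that every `f ∈ F_l` with `LP f ≤ l` fails at `l`. For `n ≤ l`, either `n` is in the footprint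
of `F_l`, or `LP f ≤ n` for some `f ∈ F_l`, and then `l - n ≤ l - LP f` is in the footprint of the
table. So the footprint contains at least half of the `(l₁ + 1) (l₂ + 1) > 2 t` indices below `l`, a
contradiction (`exists_recur_eq_zero`).

For the algorithm itself it suffices to maintain the invariant `Invariant`: validity before `l`,
leading exponents at the defining points of the footprint of `F_l`, and containment of this footprint
in that of the table. A step preserves it (`Invariant.step`) because a Berlekamp combination cancels
the failure (`berlekamp_spec`). A step outside `𝓢(t)` may be skipped because a failure there, together
with the points below `LP f`, would give a footprint with more than `t` points
(`recur_eq_zero_of_notMem_searchSet`).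

All validity statements are carried by `generatingAll`, which ignores the index box. This makes the
shifts in a Berlekamp combination harmless. In the lexicographic order the part of a row outside the
box is recovered from the part inside it, since a row of correlations is a sum of at most `t`
geometric sequences and hence vanishes once `t` consecutive terms do (`recur_row_eq_zero`).
-/

namespace BMS

/-! ### Counting in the plane of exponents -/

section Counting

theorem le_iff_pair (a b : Fin 2 →₀ ℕ) : a ≤ b ↔ a 0 ≤ b 0 ∧ a 1 ≤ b 1 := by
  simp [Finsupp.le_def, Fin.forall_fin_two]

theorem eq_iff_pair (a b : Fin 2 →₀ ℕ) : a = b ↔ a 0 = b 0 ∧ a 1 = b 1 := by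
  simp [Finsupp.ext_iff, Fin.forall_fin_two]

theorem card_Iic_pair (n : Fin 2 →₀ ℕ) : (Finset.Iic n).card = (n 0 + 1) * (n 1 + 1) := by
  classical
  rw [Finsupp.card_Iic, ← Fin.prod_univ_two (fun i => n i + 1)]
  simp only [Nat.card_Iic]
  refine Finset.prod_subset (Finset.subset_univ _) fun i _ hi => ?_
  rw [Finsupp.notMem_support_iff.mp hi, zero_add]

/-- The arithmetic behind `add_le_card_Iio_union_Iic`: a bound for the overlap of the rectangles below
`(a, b)` and below `(p, q)` when the first is not contained in the second. -/
theorem succ_min_mul_succ_min_le {a b p q : ℕ} (hap : 1 ≤ a + p) (hbq : 1 ≤ b + q)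
    (h : ¬ (a ≤ p ∧ b ≤ q)) :
    (min a p + 1) * (min b q + 1) ≤ a * b + p * q + 1 := by
  rcases le_total a p with h1 | h1 <;> rcases le_total b q with h2 | h2 <;>
    simp only [min_eq_left, min_eq_right, h1, h2]
  · exact absurd ⟨h1, h2⟩ h
  · obtain ⟨d, rfl⟩ := Nat.exists_eq_add_of_le h1
    have : q + 1 ≤ b := by by_contra hc; exact h ⟨h1, by omega⟩
    obtain ⟨c, rfl⟩ := Nat.exists_eq_add_of_le this
    rcases Nat.eq_zero_or_pos a with rfl | ha
    · nlinarith [Nat.mul_le_mul_right q (show 1 ≤ d by omega)]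
    · nlinarith [Nat.zero_le (d * q), Nat.mul_le_mul_right q ha, Nat.zero_le (a * c)]
  · obtain ⟨d, rfl⟩ := Nat.exists_eq_add_of_le h2
    have : p + 1 ≤ a := by by_contra hc; exact h ⟨by omega, h2⟩
    obtain ⟨c, rfl⟩ := Nat.exists_eq_add_of_le this
    rcases Nat.eq_zero_or_pos b with rfl | hb
    · nlinarith [Nat.mul_le_mul_left p (show 1 ≤ d by omega)]
    · nlinarith [Nat.zero_le (d * p), Nat.mul_le_mul_right p hb, Nat.zero_le (b * c)]
  · rcases Nat.lt_or_ge p a with h3 | h3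
    · obtain ⟨c, rfl⟩ := Nat.exists_eq_add_of_le h3
      obtain ⟨d, rfl⟩ := Nat.exists_eq_add_of_le h2
      rcases Nat.eq_zero_or_pos q with rfl | hq
      · nlinarith [Nat.mul_le_mul_left p (show 1 ≤ d by omega), Nat.zero_le (c * d)]
      · nlinarith [Nat.mul_le_mul_left p hq, Nat.zero_le (c * q), Nat.zero_le (c * d),
          Nat.zero_le (p * d)]
    · have : q + 1 ≤ b := by by_contra hc; exact h ⟨h3, by omega⟩
      obtain rfl : p = a := le_antisymm h1 h3
      obtain ⟨c, rfl⟩ := Nat.exists_eq_add_of_le this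
      nlinarith [Nat.mul_le_mul_right q (show 1 ≤ p by omega), Nat.zero_le (p * c)]

/-- The punctured rectangle below `s` and the rectangle below `l - s` together have at least
`l₁ + l₂` points if `l` is off the axes. -/
theorem add_le_card_Iio_union_Iic {s l : Fin 2 →₀ ℕ} (hs : s ≤ l) (h0 : 0 < l 0) (h1 : 0 < l 1) :
    l 0 + l 1 ≤ (Finset.Iio s ∪ Finset.Iic (l - s)).card := by
  classical
  obtain ⟨p, rfl⟩ := exists_add_of_le hs
  rw [add_tsub_cancel_left]
  simp only [Finsupp.add_apply] at h0 h1 ⊢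
  by_cases hsp : s ≤ p
  · refine le_trans ?_ (Finset.card_le_card Finset.subset_union_right)
    rw [card_Iic_pair]
    rw [le_iff_pair] at hsp
    obtain ⟨u, hu⟩ := Nat.exists_eq_add_of_le (show 1 ≤ p 0 by omega)
    obtain ⟨v, hv⟩ := Nat.exists_eq_add_of_le (show 1 ≤ p 1 by omega)
    rw [hu, hv] at hsp ⊢
    nlinarith [Nat.zero_le (u * v)]
  · have h2 := Finset.card_union_add_card_inter (Finset.Iio s) (Finset.Iic p)
    have h3 : (Finset.Iio s ∩ Finset.Iic p).card ≤ (Finset.Iic (s ⊓ p)).card := by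
      refine Finset.card_le_card fun n hn => ?_
      rw [Finset.mem_inter, Finset.mem_Iio, Finset.mem_Iic] at hn
      exact Finset.mem_Iic.mpr (le_inf hn.1.le hn.2)
    rw [le_iff_pair] at hsp
    have h4 := succ_min_mul_succ_min_le h0 h1 hsp
    rw [Finset.card_Iio_eq_card_Iic_sub_one] at h2
    simp only [card_Iic_pair, Finsupp.inf_apply] at h2 h3
    have h5 : 1 ≤ (s 0 + 1) * (s 1 + 1) := Nat.one_le_iff_ne_zero.mpr (by simp)
    have h6 : min (s 0) (p 0) = s 0 ⊓ p 0 := rfl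
    have h7 : min (s 1) (p 1) = s 1 ⊓ p 1 := rfl
    rw [h6, h7] at h4
    zify [h5] at *
    nlinarith

/-- The analogue of `add_le_card_Iio_union_Iic` on the axes. -/
theorem add_lt_two_mul_card_Iio_union_Iic {s l : Fin 2 →₀ ℕ} (hs : s ≤ l)
    (h : l 0 = 0 ∨ l 1 = 0) :
    l 0 + l 1 < 2 * (Finset.Iio s ∪ Finset.Iic (l - s)).card := by
  classical
  obtain ⟨p, rfl⟩ := exists_add_of_le hs
  rw [add_tsub_cancel_left]
  have h2 := Finset.card_le_card (Finset.subset_union_right (s₁ := Finset.Iio s)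
    (s₂ := Finset.Iic p))
  have h3 := Finset.card_le_card (Finset.subset_union_left (s₁ := Finset.Iio s)
    (s₂ := Finset.Iic p))
  rw [Finset.card_Iio_eq_card_Iic_sub_one] at h3
  rw [card_Iic_pair] at h2 h3
  simp only [Finsupp.add_apply] at h ⊢
  have h4 : s 0 + s 1 ≤ (s 0 + 1) * (s 1 + 1) - 1 := by
    have : s 0 + s 1 + 1 ≤ (s 0 + 1) * (s 1 + 1) := by nlinarith [Nat.zero_le (s 0 * s 1)]
    omega
  have h5 : p 0 + p 1 + 1 ≤ (p 0 + 1) * (p 1 + 1) := by nlinarith [Nat.zero_le (p 0 * p 1)]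
  omega

end Counting

/-! ### Sums of geometric sequences -/

/-- A sum of `d` geometric sequences that vanishes at `0, …, d - 1` vanishes identically. -/
theorem sum_geometric_eq_zero {R ι : Type*} [CommRing R] (P : Finset ι) (c y : ι → R)
    (h : ∀ b < P.card, ∑ j ∈ P, c j * y j ^ b = 0) (b : ℕ) : ∑ j ∈ P, c j * y j ^ b = 0 := by
  nontriviality R
  -- the monic polynomial with roots `y j` is the characteristic polynomial of a linear recurrence
  set Q : Polynomial R := ∏ j ∈ P, (Polynomial.X - Polynomial.C (y j)) with hQ
  have hmon : Q.Monic := Polynomial.monic_prod_of_monic _ _ fun j _ => Polynomial.monic_X_sub_C _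
  have hdeg : Q.natDegree = P.card := by
    rw [hQ, Polynomial.natDegree_prod_of_monic _ _ fun j _ => Polynomial.monic_X_sub_C _]
    simp
  induction b using Nat.strong_induction_on with
  | _ b ih =>
    rcases Nat.lt_or_ge b P.card with hb | hb
    · exact h b hb
    · obtain ⟨k, rfl⟩ := Nat.exists_eq_add_of_le' hb
      have hrec : ∑ i ∈ Finset.range (P.card + 1),
          Q.coeff i * ∑ j ∈ P, c j * y j ^ (k + i) = 0 := by
        have hroot : ∀ j ∈ P, Q.eval (y j) = 0 := fun j hj => by
          rw [hQ, Polynomial.eval_prod]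
          exact Finset.prod_eq_zero hj (by simp)
        simp only [Finset.mul_sum]
        rw [Finset.sum_comm]
        refine Finset.sum_eq_zero fun j hj => ?_
        have := hroot j hj
        rw [Polynomial.eval_eq_sum_range, hdeg] at this
        rw [← mul_zero (c j * y j ^ k), ← this, Finset.mul_sum]
        refine Finset.sum_congr rfl fun i _ => ?_
        ring
      rw [Finset.sum_range_succ, Finset.sum_eq_zero, zero_add, ← hdeg, hmon.coeff_natDegree,
        one_mul, hdeg] at hrec
      · exact hrec
      · intro i hi
        rw [ih (k + i) (by have := Finset.mem_range.mp hi; omega), mul_zero]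

/-! ### Correlation of a polynomial with an array -/

section Correlation

variable {L : Type*} [Field L]

/-- The correlation `∑ m, f_m U (m + a)` of `f` with the array `U` at offset `a`, as a linear
function of `f`. -/
noncomputable def corr (U : (Fin 2 →₀ ℕ) → L) (a : Fin 2 →₀ ℕ) :
    MvPolynomial (Fin 2) L →ₗ[L] L :=
  (basisMonomials (Fin 2) L).constr L fun m => U (m + a)

theorem corr_monomial (U : (Fin 2 →₀ ℕ) → L) (a v : Fin 2 →₀ ℕ) (c : L) :
    corr U a (monomial v c) = c * U (v + a) := by
  have h : monomial v c = c • basisMonomials (Fin 2) L v := by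
    rw [coe_basisMonomials, smul_monomial, smul_eq_mul, mul_one]
  rw [h, map_smul, corr, Module.Basis.constr_basis, smul_eq_mul]

theorem corr_apply (U : (Fin 2 →₀ ℕ) → L) (a : Fin 2 →₀ ℕ) (f : MvPolynomial (Fin 2) L) :
    corr U a f = ∑ m ∈ f.support, f.coeff m * U (m + a) := by
  conv_lhs => rw [f.as_sum]
  simp only [map_sum, corr_monomial]

theorem corr_monomial_mul (U : (Fin 2 →₀ ℕ) → L) (a v : Fin 2 →₀ ℕ) (c : L)
    (f : MvPolynomial (Fin 2) L) : corr U a (monomial v c * f) = c * corr U (a + v) f := by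
  rw [f.as_sum, Finset.mul_sum]
  simp only [map_sum, monomial_mul, corr_monomial, Finset.mul_sum]
  refine Finset.sum_congr rfl fun m _ => ?_
  rw [mul_assoc, show v + m + a = m + (a + v) by abel]

theorem corr_mul (U : (Fin 2 →₀ ℕ) → L) (a : Fin 2 →₀ ℕ) (f g : MvPolynomial (Fin 2) L) :
    corr U a (f * g) = ∑ m ∈ f.support, f.coeff m * corr U (a + m) g := by
  conv_lhs => rw [f.as_sum, Finset.sum_mul]
  simp only [map_sum, corr_monomial_mul]

theorem recur_of_le (T : Ordering2) (U : (Fin 2 →₀ ℕ) → L) {f : MvPolynomial (Fin 2) L}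
    {n : Fin 2 →₀ ℕ} (h : LP T f ≤ n) : recur T U f n = corr U (n - LP T f) f := by
  rw [recur, if_pos h, corr_apply]
  exact Finset.sum_congr rfl fun m _ => by rw [add_tsub_assoc_of_le h]

theorem LP_le_of_recur_ne_zero {T : Ordering2} {U : (Fin 2 →₀ ℕ) → L}
    {f : MvPolynomial (Fin 2) L} {n : Fin 2 →₀ ℕ} (h : recur T U f n ≠ 0) : LP T f ≤ n := by
  by_contra hc
  exact h (if_neg hc)

/-- `Λ(u^l)` without the restriction to the index box: the polynomials with `f[U]_k = 0` at every
index `k <_T l`. -/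
def generatingAll (T : Ordering2) (U : (Fin 2 →₀ ℕ) → L) (l : Fin 2 →₀ ℕ) :
    Set (MvPolynomial (Fin 2) L) :=
  {f | ∀ k, (k ≺[T.toMonomialOrder] l) → recur T U f k = 0}

/-- The footprint of the ideal of all linear recurrences of `U`: the exponents which no leading
exponent of a nonzero polynomial valid on the whole array divides. -/
def footprintAll (T : Ordering2) (U : (Fin 2 →₀ ℕ) → L) : Set (Fin 2 →₀ ℕ) :=
  {n | ∀ g : MvPolynomial (Fin 2) L, g ≠ 0 → (∀ a, corr U a g = 0) → ¬ LP T g ≤ n}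

theorem lt_add_tsub {T : Ordering2} {a b l : Fin 2 →₀ ℕ} (h : a ≺[T.toMonomialOrder] b)
    (hb : b ≤ l) : a + (l - b) ≺[T.toMonomialOrder] l := by
  conv_rhs => rw [← add_tsub_cancel_of_le hb]
  rw [map_add, map_add]
  exact add_lt_add_left h _

/-- A failure at `l` of a recurrence valid up to `l` enlarges the footprint: evaluate the
correlation of `f * g` at `l - LP f - LP g` in two ways, for `g` valid on the whole array. -/
theorem Iic_subset_footprintAll {T : Ordering2} {U : (Fin 2 →₀ ℕ) → L} {l : Fin 2 →₀ ℕ}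
    {f : MvPolynomial (Fin 2) L} (hf : f ∈ generatingAll T U l) (hfl : recur T U f l ≠ 0) :
    Set.Iic (l - LP T f) ⊆ footprintAll T U := by
  intro n hn g hg0 hg hgn
  have hgl : LP T g ≤ l - LP T f := hgn.trans hn
  have hfle := LP_le_of_recur_ne_zero hfl
  obtain ⟨a, ha⟩ := exists_add_of_le hgl
  have hl : l = LP T f + LP T g + a := by
    rw [add_assoc, ← ha, add_tsub_cancel_of_le hfle]
  have h1 : corr U a (f * g) = 0 := by
    rw [corr_mul]
    exact Finset.sum_eq_zero fun m _ => by rw [hg, mul_zero]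
  rw [mul_comm, corr_mul, Finset.sum_eq_single (LP T g)] at h1
  · rw [recur_of_le T U hfle, ha, add_comm] at hfl
    exact (mul_ne_zero (T.toMonomialOrder.coeff_degree_ne_zero_iff.mpr hg0) hfl) h1
  · intro m hm hne
    have hlt : m ≺[T.toMonomialOrder] LP T g :=
      lt_of_le_of_ne (T.toMonomialOrder.le_degree hm)
        fun h => hne (T.toMonomialOrder.toSyn.injective h)
    have h2 := hf (LP T f + (a + m)) (by
      have h3 := lt_add_tsub hlt (l := l) (by rw [hl, add_right_comm]; exact le_add_self)
      rwa [show l - LP T g = LP T f + a by rw [hl, add_right_comm, add_tsub_cancel_right],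
        show m + (LP T f + a) = LP T f + (a + m) by abel] at h3)
    rw [recur_of_le T U le_self_add, add_tsub_cancel_left] at h2
    rw [h2, mul_zero]
  · intro h
    exact absurd (T.toMonomialOrder.degree_mem_support hg0) h

end Correlation

/-! ### Arrays that are sums of few exponentials -/

section ExponentialSum

variable {L ι : Type*} [Field L] {U : (Fin 2 →₀ ℕ) → L} {P : Finset ι} {c : ι → L}
  {x : ι → Fin 2 → L}

theorem corr_eq_sum_eval (hU : ∀ n, U n = ∑ j ∈ P, c j * ∏ i, x j i ^ n i) (a : Fin 2 →₀ ℕ)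
    (f : MvPolynomial (Fin 2) L) :
    corr U a f = ∑ j ∈ P, c j * (∏ i, x j i ^ a i) * eval (x j) f := by
  simp only [corr_apply, hU, eval_eq', Finset.mul_sum]
  rw [Finset.sum_comm]
  refine Finset.sum_congr rfl fun j _ => Finset.sum_congr rfl fun m _ => ?_
  simp only [Finsupp.add_apply, pow_add, Finset.prod_mul_distrib]
  ring

/-- The footprint of an array has at most as many points as the array has exponential terms: a
nonzero polynomial supported on a larger set of exponents can be made to vanish at all the bases. -/
theorem card_le_of_subset_footprintAll (T : Ordering2)
    (hU : ∀ n, U n = ∑ j ∈ P, c j * ∏ i, x j i ^ n i) {S : Finset (Fin 2 →₀ ℕ)}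
    (hS : (S : Set (Fin 2 →₀ ℕ)) ⊆ footprintAll T U) : S.card ≤ P.card := by
  by_contra! hlt
  let v : S → P → L := fun n j => ∏ i, x j i ^ (n : Fin 2 →₀ ℕ) i
  have hdep : ¬ LinearIndependent L v := fun h => by
    have := h.fintype_card_le_finrank
    simp only [Fintype.card_coe, Module.finrank_fintype_fun_eq_card] at this
    omega
  obtain ⟨w, hw, n₀, hn₀⟩ := Fintype.not_linearIndependent_iff.mp hdep
  set g : MvPolynomial (Fin 2) L := ∑ n : S, monomial (n : Fin 2 →₀ ℕ) (w n) with hg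
  have hcoeff : ∀ n : S, g.coeff n = w n := fun n => by
    rw [hg, coeff_sum, Finset.sum_eq_single n]
    · simp
    · intro k _ hk
      rw [coeff_monomial, if_neg fun h => hk (Subtype.ext h)]
    · simp
  have hg0 : g ≠ 0 := fun h => hn₀ (by rw [← hcoeff, h, coeff_zero])
  have hmem : LP T g ∈ S := by
    have h1 := T.toMonomialOrder.degree_mem_support hg0
    by_contra hc
    refine mem_support_iff.mp h1 ?_
    rw [hg, coeff_sum]
    refine Finset.sum_eq_zero fun k _ => ?_
    rw [coeff_monomial, if_neg]
    rintro h
    exact hc (by change T.toMonomialOrder.degree g ∈ S; rw [← h]; exact k.2)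
  refine hS hmem g hg0 (fun a => ?_) le_rfl
  rw [corr_eq_sum_eval hU]
  refine Finset.sum_eq_zero fun j hj => ?_
  have h2 := congrFun hw ⟨j, hj⟩
  simp only [Finset.sum_apply, Pi.smul_apply, smul_eq_mul, Pi.zero_apply, v] at h2
  rw [hg, map_sum]
  simp only [eval_monomial]
  rw [← h2]
  rw [Finset.sum_congr rfl fun n _ => by rw [Finsupp.prod_fintype _ _ (by simp)], h2, mul_zero]

/-- A recurrence that holds at `#P` consecutive indices of a row holds on the whole row. -/
theorem corr_row_eq_zero (hU : ∀ n, U n = ∑ j ∈ P, c j * ∏ i, x j i ^ n i) (a : ℕ)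
    (f : MvPolynomial (Fin 2) L) (h : ∀ b < P.card, corr U (pt a b) f = 0) (b : ℕ) :
    corr U (pt a b) f = 0 := by
  have key (b : ℕ) : corr U (pt a b) f =
      ∑ j ∈ P, (c j * x j 0 ^ a * eval (x j) f) * x j 1 ^ b := by
    rw [corr_eq_sum_eval hU]
    refine Finset.sum_congr rfl fun j _ => ?_
    rw [Fin.prod_univ_two, pt_zero, pt_one]
    ring
  rw [key]
  exact sum_geometric_eq_zero P _ _ (fun b hb => by rw [← key, h b hb]) b

theorem recur_row_eq_zero (hU : ∀ n, U n = ∑ j ∈ P, c j * ∏ i, x j i ^ n i) {T : Ordering2}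
    {f : MvPolynomial (Fin 2) L} {a N : ℕ} (hN : P.card + LP T f 1 ≤ N)
    (h : ∀ b < N, LP T f ≤ pt a b → recur T U f (pt a b) = 0) (b : ℕ) :
    recur T U f (pt a b) = 0 := by
  by_cases hle : LP T f ≤ pt a b
  · have ha : LP T f 0 ≤ a := by simpa using hle 0
    have hsub (k : ℕ) : pt a (k + LP T f 1) - LP T f = pt (a - LP T f 0) k := by
      rw [eq_iff_pair]; simp
    have hle' (k : ℕ) : LP T f ≤ pt a (k + LP T f 1) := by
      rw [le_iff_pair]; simp [ha]
    have hb : LP T f 1 ≤ b := by simpa using hle 1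
    obtain ⟨k, rfl⟩ := Nat.exists_eq_add_of_le' hb
    rw [recur_of_le T U hle, hsub]
    refine corr_row_eq_zero hU _ _ (fun d hd => ?_) k
    have := h (d + LP T f 1) (by omega) (hle' d)
    rwa [recur_of_le T U (hle' d), hsub] at this
  · exact if_neg hle

end ExponentialSum

/-! ### Defining points of a footprint and failures -/

section Staircase

variable {L : Type*} [Field L]

theorem isLowerSet_footprint (T : Ordering2) (F : Set (MvPolynomial (Fin 2) L)) :
    IsLowerSet (footprint T F) := fun _ _ hab ha f hf hfb => ha f hf (hfb.trans hab)

theorem isLowerSet_newFootprint (T : Ordering2) (U : (Fin 2 →₀ ℕ) → L) (l : Fin 2 →₀ ℕ)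
    (F : Set (MvPolynomial (Fin 2) L)) : IsLowerSet (newFootprint T U l F) := by
  rintro a b hab (ha | ⟨f, hf, ha⟩)
  · exact Or.inl (isLowerSet_footprint T F hab ha)
  · exact Or.inr ⟨f, hf, hab.trans ha⟩

theorem newFootprint_subset {T : Ordering2} {U : (Fin 2 →₀ ℕ) → L} {l : Fin 2 →₀ ℕ}
    {F : Set (MvPolynomial (Fin 2) L)} (hF : ∀ f ∈ F, f ∈ generatingAll T U l)
    (hsub : footprint T F ⊆ footprintAll T U) : newFootprint T U l F ⊆ footprintAll T U := by
  rintro n (hn | ⟨f, hf, hn⟩)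
  · exact hsub hn
  · exact Iic_subset_footprintAll (hF f hf.1) hf.2 hn

/-- A set of polynomials whose leading exponents are the minimal points outside a lower set `D` of
exponents has footprint `D`. -/
theorem footprint_eq_of_minimal {T : Ordering2} {F : Set (MvPolynomial (Fin 2) L)}
    {D : Set (Fin 2 →₀ ℕ)} (hD : IsLowerSet D) (h1 : ∀ f ∈ F, Minimal (· ∉ D) (LP T f))
    (h2 : ∀ s, Minimal (· ∉ D) s → ∃ f ∈ F, LP T f = s) : footprint T F = D := by
  ext n
  constructor
  · intro hn
    by_contra hc
    obtain ⟨s, hs, hmin⟩ := exists_minimal_le_of_wellFoundedLT (· ∉ D) n hc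
    obtain ⟨f, hf, rfl⟩ := h2 s hmin
    exact hn f hf hs
  · exact fun hn f hf hle => (h1 f hf).prop (hD hle hn)

theorem coe_Iio_subset_of_minimal {D : Set (Fin 2 →₀ ℕ)} {s : Fin 2 →₀ ℕ}
    (hs : Minimal (· ∉ D) s) : ((Finset.Iio s : Finset (Fin 2 →₀ ℕ)) : Set (Fin 2 →₀ ℕ)) ⊆ D := by
  intro n hn
  rw [Finset.coe_Iio, Set.mem_Iio] at hn
  by_contra hc
  exact hs.not_prop_of_lt hn hc

variable {ι : Type*} {U : (Fin 2 →₀ ℕ) → L} {P : Finset ι} {c : ι → L} {x : ι → Fin 2 → L}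

/-- A minimal point `s` outside a part of the footprint has a small second coordinate: the points below
it belong to the footprint. -/
theorem apply_one_le_of_minimal (T : Ordering2)
    (hU : ∀ n, U n = ∑ j ∈ P, c j * ∏ i, x j i ^ n i) {D : Set (Fin 2 →₀ ℕ)}
    (hD : D ⊆ footprintAll T U) {s : Fin 2 →₀ ℕ} (hs : Minimal (· ∉ D) s) : s 1 ≤ P.card := by
  have h1 := card_le_of_subset_footprintAll T hU ((coe_Iio_subset_of_minimal hs).trans hD)
  rw [Finset.card_Iio_eq_card_Iic_sub_one, card_Iic_pair] at h1
  have : s 1 + 1 ≤ (s 0 + 1) * (s 1 + 1) := Nat.le_mul_of_pos_left _ (Nat.succ_pos _)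
  omega

/-- No recurrence with a minimal leading exponent fails outside `𝓢(t)`, since its failure would
make the footprint too large. -/
theorem recur_eq_zero_of_notMem_searchSet {T : Ordering2}
    (hU : ∀ n, U n = ∑ j ∈ P, c j * ∏ i, x j i ^ n i) {t : ℕ} (ht : P.card ≤ t)
    {r : Fin 2 → ℕ} {l : Fin 2 →₀ ℕ} (hl : l ∈ box r) (hlt : l ∉ searchSet r t)
    {D : Set (Fin 2 →₀ ℕ)} (hD : D ⊆ footprintAll T U) {f : MvPolynomial (Fin 2) L}
    (hs : Minimal (· ∉ D) (LP T f)) (hf : f ∈ generatingAll T U l) : recur T U f l = 0 := by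
  classical
  by_contra hfail
  have hle := LP_le_of_recur_ne_zero hfail
  have hsub : ((Finset.Iio (LP T f) ∪ Finset.Iic (l - LP T f) : Finset (Fin 2 →₀ ℕ)) :
      Set (Fin 2 →₀ ℕ)) ⊆ footprintAll T U := by
    rw [Finset.coe_union, Finset.coe_Iic]
    exact Set.union_subset ((coe_Iio_subset_of_minimal hs).trans hD)
      (Iic_subset_footprintAll hf hfail)
  have hcard := card_le_of_subset_footprintAll T hU hsub
  have hout : ¬ ((l 0 = 0 ∧ l 1 < 2 * t) ∨ (l 1 = 0 ∧ l 0 < 2 * t) ∨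
      (l 0 ≠ 0 ∧ l 1 ≠ 0 ∧ l 0 + l 1 ≤ t)) := fun h => hlt ⟨hl, h⟩
  by_cases h0 : l 0 = 0 ∨ l 1 = 0
  · have := add_lt_two_mul_card_Iio_union_Iic hle h0
    omega
  · have := add_le_card_Iio_union_Iic hle (by omega) (by omega)
    omega

end Staircase

/-! ### The successor function -/

section Order

variable {L : Type*} [Field L]

/-- The indices that the successor function reaches from `(0, 0)` without leaving the index box:
whole rows for the lexicographic order, degree at most `t` for the graded order. -/
def InRange (r : Fin 2 → ℕ) (t : ℕ) (l : Fin 2 →₀ ℕ) : Ordering2 → Prop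
  | .lex => l 0 < r 0 ∧ l 1 < r 1
  | .graded => l 0 + l 1 ≤ t

theorem InRange.mem_box {r : Fin 2 → ℕ} {t : ℕ} {l : Fin 2 →₀ ℕ} {T : Ordering2}
    (h : InRange r t l T) (ht : ∀ i, t < r i) : l ∈ box r := by
  have h0 := ht 0
  have h1 := ht 1
  intro i
  cases T <;> fin_cases i <;> simp only [InRange] at h <;> simp <;> omega

theorem InRange.of_next {r : Fin 2 → ℕ} {t : ℕ} {l : Fin 2 →₀ ℕ} {T : Ordering2}
    (h1 : T = .lex → l 1 < r 1) (h : InRange r t (T.next r l) T) : InRange r t l T := by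
  cases T
  · simp only [InRange, Ordering2.next] at h ⊢
    refine ⟨?_, h1 rfl⟩
    split_ifs at h <;> simp only [pt_zero, pt_one] at h <;> omega
  · simp only [InRange, Ordering2.next] at h ⊢
    split_ifs at h <;> simp only [pt_zero, pt_one] at h <;> omega

theorem lt_next (T : Ordering2) (r : Fin 2 → ℕ) (l : Fin 2 →₀ ℕ) :
    l ≺[T.toMonomialOrder] T.next r l := by
  cases T
  · rw [lex_lt_iff]
    simp only [Ordering2.next]
    split_ifs <;> simp
  · rw [graded_lt_iff]
    simp only [Ordering2.next]
    split_ifs <;> simp <;> omega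

/-- In the last case `k` lies in the row of `l` and `l` is at the end of that row within the box, so
that `k` may lie beyond the box. -/
theorem lt_or_eq_of_lt_next {T : Ordering2} {r : Fin 2 → ℕ} {l k : Fin 2 →₀ ℕ}
    (hk : k ≺[T.toMonomialOrder] T.next r l) :
    (k ≺[T.toMonomialOrder] l) ∨ k = l ∨ (T = .lex ∧ k 0 = l 0 ∧ r 1 - 1 ≤ l 1) := by
  rw [eq_iff_pair]
  cases T
  · rw [lex_lt_iff] at hk ⊢
    simp only [Ordering2.next] at hk
    split_ifs at hk <;> simp only [pt_zero, pt_one] at hk <;> simp <;> omega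
  · rw [graded_lt_iff] at hk ⊢
    simp only [Ordering2.next] at hk
    split_ifs at hk <;> simp only [pt_zero, pt_one] at hk <;> simp <;> omega

variable {ι : Type*} {U : (Fin 2 →₀ ℕ) → L} {P : Finset ι} {c : ι → L} {x : ι → Fin 2 → L}

/-- Recurrences that hold at the indices of the box before `l` hold at all indices before `l`:
for the lexicographic order each complete row before `l` extends beyond the box. -/
theorem mem_generatingAll_of_mem_generating {T : Ordering2}
    (hU : ∀ n, U n = ∑ j ∈ P, c j * ∏ i, x j i ^ n i) {r : Fin 2 → ℕ} {t : ℕ}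
    (ht : ∀ i, t < r i) {l : Fin 2 →₀ ℕ} (hl : InRange r t l T) {f : MvPolynomial (Fin 2) L}
    (hdeg : P.card + LP T f 1 ≤ r 1) (hf : f ∈ generating T r U l) :
    f ∈ generatingAll T U l := by
  intro k hk
  by_cases hle : LP T f ≤ k
  swap
  · exact if_neg hle
  by_cases hbox : k ∈ box r
  · exact hf k hbox hk hle
  have h0 := ht 0
  have h1 := ht 1
  have hbox' : ¬ (k 0 < r 0 ∧ k 1 < r 1) := fun h => hbox fun i => by
    fin_cases i
    exacts [h.1, h.2]
  cases T
  · rw [lex_lt_iff] at hk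
    simp only [InRange] at hl
    have hpt : k = pt (k 0) (k 1) := by rw [eq_iff_pair]; simp
    rw [hpt]
    refine recur_row_eq_zero hU hdeg (fun b hb hle' => hf _ (fun i => ?_) ?_ hle') _
    · fin_cases i <;> simp <;> omega
    · rw [lex_lt_iff, pt_zero, pt_one]
      omega
  · rw [graded_lt_iff] at hk
    simp only [InRange] at hl
    omega

/-- Passing to the successor needs only the validity at `l`: where `l` ends a row within the box, the
recurrence already holds on the rest of that row. -/
theorem mem_generatingAll_next {T : Ordering2}
    (hU : ∀ n, U n = ∑ j ∈ P, c j * ∏ i, x j i ^ n i) {r : Fin 2 → ℕ} {l : Fin 2 →₀ ℕ}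
    {f : MvPolynomial (Fin 2) L} (hdeg : P.card + LP T f 1 ≤ r 1)
    (hf : f ∈ generatingAll T U l) (hfl : recur T U f l = 0) :
    f ∈ generatingAll T U (T.next r l) := by
  intro k hk
  rcases lt_or_eq_of_lt_next hk with h | rfl | ⟨rfl, h0, h1⟩
  · exact hf k h
  · exact hfl
  · have hpt (n : Fin 2 →₀ ℕ) : n = pt (n 0) (n 1) := by rw [eq_iff_pair]; simp
    rw [hpt k]
    refine recur_row_eq_zero hU hdeg (fun b hb _ => ?_) _
    by_cases hbl : b = l 1
    · rw [h0, hbl, ← hpt l, hfl]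
    · refine hf _ ?_
      rw [lex_lt_iff, pt_zero, pt_one]
      omega

end Order

/-! ### Correctness of a step -/

section Step

variable {L : Type*} [Field L]

theorem LP_monomial_mul (T : Ordering2) (v : Fin 2 →₀ ℕ) {a : L} (ha : a ≠ 0)
    {f : MvPolynomial (Fin 2) L} (hf : f ≠ 0) : LP T (monomial v a * f) = v + LP T f := by
  classical
  rw [LP, T.toMonomialOrder.degree_mul (by simpa using ha) hf,
    T.toMonomialOrder.degree_monomial, if_neg ha, LP]

theorem ne_zero_of_recur_ne_zero {T : Ordering2} {U : (Fin 2 →₀ ℕ) → L}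
    {f : MvPolynomial (Fin 2) L} {n : Fin 2 →₀ ℕ} (h : recur T U f n ≠ 0) : f ≠ 0 := by
  rintro rfl
  simp [recur] at h

/-- The auxiliary pair `(g, k)` records a first failure at an index `k` before `l`. -/
def IsAuxiliary (T : Ordering2) (U : (Fin 2 →₀ ℕ) → L) (l : Fin 2 →₀ ℕ)
    (p : MvPolynomial (Fin 2) L × (Fin 2 →₀ ℕ)) : Prop :=
  p.1 ∈ generatingAll T U p.2 ∧ recur T U p.1 p.2 ≠ 0 ∧ p.2 ≺[T.toMonomialOrder] l

/-- The Berlekamp combination is a nonzero polynomial, still valid before `l` and now valid at `l` as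
well: the second term has a smaller leading exponent, and it is shifted so that the failure of the
auxiliary polynomial at its index cancels the failure of `f` at `l`. -/
theorem berlekamp_spec {T : Ordering2} {U : (Fin 2 →₀ ℕ) → L} {l s : Fin 2 →₀ ℕ}
    {f : MvPolynomial (Fin 2) L} {p : MvPolynomial (Fin 2) L × (Fin 2 →₀ ℕ)}
    (hf : f ∈ generatingAll T U l) (hfl : recur T U f l ≠ 0) (hp : IsAuxiliary T U l p)
    (hfs : LP T f ≤ s) (hls : l ≤ s + span T p) :
    berlekamp T U l s f p ≠ 0 ∧ berlekamp T U l s f p ∈ generatingAll T U l ∧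
      recur T U (berlekamp T U l s f p) l = 0 := by
  obtain ⟨g, k⟩ := p
  obtain ⟨hg, hgk, hkl⟩ := hp
  dsimp only at hg hgk hkl
  have hf0 := ne_zero_of_recur_ne_zero hfl
  have hg0 := ne_zero_of_recur_ne_zero hgk
  have hgle := LP_le_of_recur_ne_zero hgk
  obtain ⟨v, hv⟩ := exists_add_of_le hls
  obtain ⟨w, rfl⟩ := exists_add_of_le hfs
  obtain ⟨c, hc⟩ := exists_add_of_le hgle
  simp only [span] at hv
  rw [hc, add_tsub_cancel_left] at hv
  set q := recur T U f l / recur T U g k with hq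
  have hq0 : q ≠ 0 := div_ne_zero hfl hgk
  have hb : berlekamp T U l (LP T f + w) f (g, k) = monomial w 1 * f - monomial v q * g := by
    simp only [berlekamp, span]
    rw [hc, add_tsub_cancel_left, add_tsub_cancel_left, hv, add_tsub_cancel_left, ← hc]
  rw [hb]
  have hd1 := LP_monomial_mul T w (one_ne_zero (α := L)) hf0
  have hd2 := LP_monomial_mul T v hq0 hg0
  have hlt : v + LP T g ≺[T.toMonomialOrder] w + LP T f := by
    have h1 : l + (v + LP T g) = (w + LP T f) + k := by
      rw [hc, ← add_assoc, ← hv]; abel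
    have h2 := congrArg T.toMonomialOrder.toSyn h1
    rw [map_add, map_add _ (w + LP T f)] at h2
    by_contra! hle
    have h3 := add_lt_add_of_le_of_lt hle hkl
    rw [← h2, add_comm] at h3
    exact lt_irrefl _ h3
  have hLP : LP T (monomial w 1 * f - monomial v q * g) = LP T f + w := by
    rw [LP, T.toMonomialOrder.degree_sub_of_lt]
    · exact hd1.trans (add_comm _ _)
    · rw [← LP, ← LP, hd1, hd2]; exact hlt
  -- the value of the combination at `n`, where `n + k - l` is the index at which `g` is evaluated
  have hrec (n d : Fin 2 →₀ ℕ) (hn : LP T f + w + d = n) :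
      recur T U (monomial w 1 * f - monomial v q * g) n =
        recur T U f n - q * recur T U g (LP T g + (v + d)) := by
    subst hn
    rw [recur_of_le T U (hLP.le.trans le_self_add), hLP, map_sub, corr_monomial_mul,
      corr_monomial_mul, one_mul, recur_of_le T U (by rw [add_assoc]; exact le_self_add),
      recur_of_le T U le_self_add, add_tsub_cancel_left, add_tsub_cancel_left, add_assoc (LP T f),
      add_tsub_cancel_left, add_comm d w, add_comm d v]
  have hshift (d : Fin 2 →₀ ℕ) : l + (LP T g + (v + d)) = (LP T f + w + d) + k := by
    rw [hc, show l + (LP T g + (v + d)) = LP T g + d + (l + v) by abel, ← hv]; abel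
  refine ⟨?_, ?_, ?_⟩
  · rw [sub_ne_zero]
    intro h
    rw [← hd1, ← hd2, h] at hlt
    exact lt_irrefl _ hlt
  · intro n hn
    by_cases hle : LP T f + w ≤ n
    · obtain ⟨d, rfl⟩ := exists_add_of_le hle
      rw [hrec _ d rfl, hf _ hn, hg, mul_zero, sub_zero]
      have h2 := congrArg T.toMonomialOrder.toSyn (hshift d)
      rw [map_add, map_add _ (LP T f + w + d)] at h2
      by_contra! hle
      exact absurd h2 (ne_of_gt (add_lt_add_of_lt_of_le hn hle))
    · exact if_neg (by rwa [hLP])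
  · by_cases hle : LP T f + w ≤ l
    · obtain ⟨d, hd⟩ := exists_add_of_le hle
      have h2 := hshift d
      rw [← hd] at h2
      rw [hrec _ d hd.symm, add_left_cancel h2, hq, div_mul_cancel₀ _ hgk, sub_self]
    · exact if_neg (by rwa [hLP])

/-- A shift of a failing polynomial to a leading exponent `s` with `¬ s ≤ l` is valid at `l`, where
the recurrence no longer applies. -/
theorem shift_spec {T : Ordering2} {U : (Fin 2 →₀ ℕ) → L} {l s : Fin 2 →₀ ℕ}
    {f : MvPolynomial (Fin 2) L} (hf : f ∈ generatingAll T U l) (hf0 : f ≠ 0)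
    (hfs : LP T f ≤ s) (hsl : ¬ s ≤ l) :
    monomial (s - LP T f) 1 * f ≠ 0 ∧ monomial (s - LP T f) 1 * f ∈ generatingAll T U l ∧
      recur T U (monomial (s - LP T f) 1 * f) l = 0 := by
  have hLP : LP T (monomial (s - LP T f) 1 * f) = s := by
    rw [LP_monomial_mul T _ one_ne_zero hf0, tsub_add_cancel_of_le hfs]
  refine ⟨mul_ne_zero (by simp) hf0, fun n hn => ?_, if_neg (by rwa [hLP])⟩
  by_cases hle : s ≤ n
  · rw [recur_of_le T U (by rwa [hLP]), hLP, corr_monomial_mul, one_mul,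
      tsub_add_tsub_cancel hle hfs, ← recur_of_le T U (hfs.trans hle), hf n hn]
  · exact if_neg (by rwa [hLP])

/-- What the algorithm maintains at the index `l`: the polynomials are valid before `l`, their
leading exponents are the defining points of a part of the footprint of the whole array, and the
auxiliary pairs record failures. -/
structure Invariant (T : Ordering2) (U : (Fin 2 →₀ ℕ) → L) (l : Fin 2 →₀ ℕ)
    (F : Set (MvPolynomial (Fin 2) L)) (G : Set (MvPolynomial (Fin 2) L × (Fin 2 →₀ ℕ))) :
    Prop where
  ne_zero : ∀ f ∈ F, f ≠ 0
  valid : ∀ f ∈ F, f ∈ generatingAll T U l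
  minimal : ∀ f ∈ F, Minimal (· ∉ footprint T F) (LP T f)
  subset : footprint T F ⊆ footprintAll T U
  auxiliary : ∀ p ∈ G, IsAuxiliary T U l p

theorem IsNewPoly.spec {T : Ordering2} {U : (Fin 2 →₀ ℕ) → L} {l : Fin 2 →₀ ℕ}
    {F : Set (MvPolynomial (Fin 2) L)} {G : Set (MvPolynomial (Fin 2) L × (Fin 2 →₀ ℕ))}
    {s : Fin 2 →₀ ℕ} {h : MvPolynomial (Fin 2) L} (hinv : Invariant T U l F G)
    (hnew : IsNewPoly T U l F G s h) :
    h ≠ 0 ∧ h ∈ generatingAll T U l ∧ recur T U h l = 0 := by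
  rcases hnew with ⟨hF, h0, -⟩ | ⟨f, hf, p, hp, rfl, rfl⟩ | ⟨f, hf, hfs, hsl, rfl⟩
  · exact ⟨hinv.ne_zero h hF, hinv.valid h hF, h0⟩
  · refine berlekamp_spec (hinv.valid f hf.1) hf.2 (hinv.auxiliary p hp) le_sup_left ?_
    exact tsub_le_iff_right.mp le_sup_right
  · exact shift_spec (hinv.valid f hf.1) (hinv.ne_zero f hf.1) hfs hsl

theorem Invariant.init (T : Ordering2) (U : (Fin 2 →₀ ℕ) → L) :
    Invariant T U 0 {1} ∅ := by
  have hLP : LP T (1 : MvPolynomial (Fin 2) L) = 0 := T.toMonomialOrder.degree_one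
  have hfoot : footprint T ({1} : Set (MvPolynomial (Fin 2) L)) = ∅ := by
    ext n
    simp [footprint, hLP]
  refine ⟨by simp, ?_, ?_, by simp [hfoot], by simp⟩
  · rintro f - k hk
    rw [map_zero] at hk
    exact absurd hk (not_lt.mpr (T.toMonomialOrder.zero_le _))
  · rintro f rfl
    rw [hfoot, hLP]
    exact ⟨by simp, fun n _ _ => zero_le⟩

variable {ι : Type*} {U : (Fin 2 →₀ ℕ) → L} {P : Finset ι} {c : ι → L} {x : ι → Fin 2 → L}

theorem Invariant.next_of_recur_eq_zero {T : Ordering2}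
    (hU : ∀ n, U n = ∑ j ∈ P, c j * ∏ i, x j i ^ n i) {r : Fin 2 → ℕ} (hr : 2 * P.card ≤ r 1)
    {l : Fin 2 →₀ ℕ} {F : Set (MvPolynomial (Fin 2) L)}
    {G : Set (MvPolynomial (Fin 2) L × (Fin 2 →₀ ℕ))} (hinv : Invariant T U l F G)
    (h : ∀ f ∈ F, recur T U f l = 0) : Invariant T U (T.next r l) F G where
  ne_zero := hinv.ne_zero
  valid f hf := mem_generatingAll_next hU
    (by have := apply_one_le_of_minimal T hU hinv.subset (hinv.minimal f hf); omega)
    (hinv.valid f hf) (h f hf)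
  minimal := hinv.minimal
  subset := hinv.subset
  auxiliary p hp :=
    ⟨(hinv.auxiliary p hp).1, (hinv.auxiliary p hp).2.1,
      (hinv.auxiliary p hp).2.2.trans (lt_next T r l)⟩

theorem Invariant.step {T : Ordering2}
    (hU : ∀ n, U n = ∑ j ∈ P, c j * ∏ i, x j i ^ n i) {r : Fin 2 → ℕ} (hr : 2 * P.card ≤ r 1)
    {l : Fin 2 →₀ ℕ} {F F' : Set (MvPolynomial (Fin 2) L)}
    {G G' : Set (MvPolynomial (Fin 2) L × (Fin 2 →₀ ℕ))} (hinv : Invariant T U l F G)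
    (hstep : IsStep T U l F G F' G') : Invariant T U (T.next r l) F' G' := by
  rcases hstep with ⟨hno, rfl, rfl⟩ | ⟨-, hF', hex, hG', -⟩
  · refine hinv.next_of_recur_eq_zero hU hr fun f hf => ?_
    by_contra hc
    exact Set.notMem_empty f (hno ▸ ⟨hf, hc⟩)
  · have hfoot : footprint T F' = newFootprint T U l F :=
      footprint_eq_of_minimal (isLowerSet_newFootprint T U l F) (fun h hh => (hF' h hh).1)
        fun s hs => (hex s hs).exists
    have hsub := newFootprint_subset hinv.valid hinv.subset
    refine ⟨fun h hh => ((hF' h hh).2.spec hinv).1, fun h hh => ?_, fun h hh => ?_, ?_,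
      fun p hp => ?_⟩
    · obtain ⟨-, hval, h0⟩ := (hF' h hh).2.spec hinv
      have := apply_one_le_of_minimal T hU hsub (hF' h hh).1
      exact mem_generatingAll_next hU (by omega) hval h0
    · rw [hfoot]
      exact (hF' h hh).1
    · rw [hfoot]
      exact hsub
    · rcases (hG' p hp).2 with hG | ⟨-, hfail, hp2⟩
      · obtain ⟨h1, h2, h3⟩ := hinv.auxiliary p hG
        exact ⟨h1, h2, h3.trans (lt_next T r l)⟩
      · refine ⟨?_, ?_, ?_⟩ <;> rw [hp2]
        exacts [hinv.valid _ hfail.1, hfail.2, lt_next T r l]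

theorem BMSRun.apply_one_lt {T : Ordering2} {r : Fin 2 → ℕ} (hr : 0 < r 1) {t : ℕ}
    {l : Fin 2 →₀ ℕ} {F : Set (MvPolynomial (Fin 2) L)}
    {G : Set (MvPolynomial (Fin 2) L × (Fin 2 →₀ ℕ))} (hrun : BMSRun T r U t l F G)
    (hT : T = .lex) : l 1 < r 1 := by
  subst hT
  cases hrun with
  | init => simpa using hr
  | step _ _ | skip _ _ =>
    simp only [Ordering2.next]
    split_ifs <;> simp <;> omega

theorem BMSRun.invariant {T : Ordering2}
    (hU : ∀ n, U n = ∑ j ∈ P, c j * ∏ i, x j i ^ n i) {r : Fin 2 → ℕ} {t : ℕ} (hP : P.card ≤ t)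
    (hr : ∀ i, 2 * t ≤ r i) (ht : ∀ i, t < r i) {l : Fin 2 →₀ ℕ}
    {F : Set (MvPolynomial (Fin 2) L)} {G : Set (MvPolynomial (Fin 2) L × (Fin 2 →₀ ℕ))}
    (hrun : BMSRun T r U t l F G) (hl : InRange r t l T) : Invariant T U l F G := by
  have hr1 : 2 * P.card ≤ r 1 := by have := hr 1; omega
  have hpos : 0 < r 1 := by have := ht 1; omega
  induction hrun with
  | init => exact Invariant.init T U
  | step hrun hstep ih =>
    exact (ih (hl.of_next (hrun.apply_one_lt hpos))).step hU hr1 hstep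
  | skip hrun hskip ih =>
    have hl' := hl.of_next (hrun.apply_one_lt hpos)
    have hinv := ih hl'
    refine hinv.next_of_recur_eq_zero hU hr1 fun f hf => ?_
    exact recur_eq_zero_of_notMem_searchSet hU hP (hl'.mem_box ht) hskip hinv.subset
      (hinv.minimal f hf) (hinv.valid f hf)

end Step

/-! ### A valid recurrence at the index `l` -/

section Prediction

variable {L : Type*} [Field L]

theorem syndromeTable_eq_sum {K : Type*} [Field K] [Algebra K L] (α : Fin 2 → L)
    (τ : Fin 2 →₀ ℕ) (e : MvPolynomial (Fin 2) K) (n : Fin 2 →₀ ℕ) :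
    syndromeTable α τ e n = ∑ m ∈ e.support,
      (algebraMap K L (e.coeff m) * ∏ i, α i ^ (τ i * m i)) * ∏ i, (α i ^ m i) ^ n i := by
  rw [syndromeTable, aeval_def, eval₂_eq']
  refine Finset.sum_congr rfl fun m _ => ?_
  simp only [Fin.prod_univ_two, ← pow_mul]
  ring

/-- The footprint of a minimal set lies in the footprint of the whole array, because a polynomial
valid on the whole array is in particular valid before `l`. -/
theorem IsMinimalSet.footprint_subset {T : Ordering2} {r : Fin 2 → ℕ} {U : (Fin 2 →₀ ℕ) → L}
    {l : Fin 2 →₀ ℕ} {F : Set (MvPolynomial (Fin 2) L)} (hF : IsMinimalSet T r U l F) :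
    footprint T F ⊆ footprintAll T U := by
  intro n hn g hg0 hg hgn
  refine hF.2 g hg0 (isLowerSet_footprint T F hgn hn) fun k _ _ hle => ?_
  rw [recur_of_le T U hle, hg]

/-- If every polynomial applicable at `l` failed there, then of the two indices `n` and `l - n` one
would always be in the footprint of the array, which would then contain half of the rectangle below
`l`. -/
theorem exists_recur_eq_zero {T : Ordering2} {U : (Fin 2 →₀ ℕ) → L} {l : Fin 2 →₀ ℕ}
    {F : Set (MvPolynomial (Fin 2) L)} {N : ℕ}
    (hcard : ∀ S : Finset (Fin 2 →₀ ℕ), (S : Set (Fin 2 →₀ ℕ)) ⊆ footprintAll T U → S.card ≤ N)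
    (hN : 2 * N < (l 0 + 1) * (l 1 + 1)) (hsub : footprint T F ⊆ footprintAll T U)
    (hF : ∀ f ∈ F, LP T f ≤ l → f ∈ generatingAll T U l) :
    ∃ f ∈ F, LP T f ≤ l ∧ recur T U f l = 0 := by
  classical
  by_contra! hfail
  set S := (Finset.Iic l).filter (· ∈ footprintAll T U) with hS
  have hcover : Finset.Iic l ⊆ S ∪ S.image (l - ·) := by
    intro n hn
    rw [Finset.mem_Iic] at hn
    rw [Finset.mem_union, Finset.mem_image]
    by_cases h : n ∈ footprintAll T U
    · exact Or.inl (Finset.mem_filter.mpr ⟨Finset.mem_Iic.mpr hn, h⟩)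
    · refine Or.inr ⟨l - n, Finset.mem_filter.mpr ⟨Finset.mem_Iic.mpr tsub_le_self, ?_⟩,
        tsub_tsub_cancel_of_le hn⟩
      have h1 : n ∉ footprint T F := fun hc => h (hsub hc)
      simp only [footprint, Set.mem_ofPred_eq, not_forall, not_not] at h1
      obtain ⟨f, hf, hfn⟩ := h1
      have hfl := hfn.trans hn
      exact Iic_subset_footprintAll (hF f hf hfl) (hfail f hf hfl) (tsub_le_tsub_left hfn l)
  have h1 := Finset.card_le_card hcover
  have h2 := Finset.card_union_le S (S.image (l - ·))
  have h3 : (S.image (l - ·)).card ≤ S.card := Finset.card_image_le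
  have h4 := hcard S fun n hn => (Finset.mem_filter.mp hn).2
  rw [card_Iic_pair] at h1
  omega

/-- A recurrence that holds at `l` gives the value of the array there. -/
theorem apply_eq_of_recur_eq_zero {T : Ordering2} {U : (Fin 2 →₀ ℕ) → L} {l : Fin 2 →₀ ℕ}
    {f : MvPolynomial (Fin 2) L} (hf0 : f ≠ 0) (hle : LP T f ≤ l) (h : recur T U f l = 0) :
    U l = -(f.coeff (LP T f))⁻¹ *
      ∑ m ∈ f.support.erase (LP T f), f.coeff m * U (m + l - LP T f) := by
  have hc : f.coeff (LP T f) ≠ 0 := T.toMonomialOrder.coeff_degree_ne_zero_iff.mpr hf0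
  rw [recur, if_pos hle, ← Finset.add_sum_erase _ _ (T.toMonomialOrder.degree_mem_support hf0),
    ← LP, add_tsub_cancel_left] at h
  rw [eq_neg_of_add_eq_zero_right h, neg_mul_neg, inv_mul_cancel_left₀ hc]

theorem add_tsub_LP_lt {T : Ordering2} {l m : Fin 2 →₀ ℕ} {f : MvPolynomial (Fin 2) L}
    (hle : LP T f ≤ l) (hm : m ∈ f.support.erase (LP T f)) :
    m + l - LP T f ≺[T.toMonomialOrder] l := by
  obtain ⟨hne, hm⟩ := Finset.mem_erase.mp hm
  rw [add_tsub_assoc_of_le hle]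
  exact lt_add_tsub (lt_of_le_of_ne (T.toMonomialOrder.le_degree hm)
    fun h => hne (T.toMonomialOrder.toSyn.injective h)) hle

end Prediction

end BMS

theorem mainTheorem1 {K L : Type*} [Field K] [Finite K] [Field L] [Algebra K L]
    (r : Fin 2 → ℕ) (hr : ∀ i, 0 < r i) (hcop : Nat.Coprime (Nat.card K) (r 0 * r 1))
    (α : Fin 2 → L) (hα : ∀ i, IsPrimitiveRoot (α i) (r i))
    (t : ℕ) (ht : ∀ i, t ≤ r i / 2)
    (e : MvPolynomial (Fin 2) K) (he : ∀ m ∈ e.support, m ∈ BMS.box r)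
    (hw : e.support.card ≤ t)
    (τ : Fin 2 →₀ ℕ) (hτ : τ ∈ BMS.box r)
    (U : (Fin 2 →₀ ℕ) → L) (hU : U = BMS.syndromeTable α τ e)
    (T : BMS.Ordering2) (hT : T.Condition U t)
    (l : Fin 2 →₀ ℕ) (hl : l 0 + l 1 = t) (hl0 : 1 < l 0) (hl1 : 1 < l 1)
    (F : Set (MvPolynomial (Fin 2) L))
    (hF : (∃ G, BMS.BMSRun T r U t l F G) ∨ BMS.IsMinimalSet T r U l F) :
    ∃ f ∈ F, BMS.LP T f ≤ l ∧ BMS.recur T U f l = 0 ∧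
      (∀ m ∈ f.support.erase (BMS.LP T f), m + l - BMS.LP T f ≺[T.toMonomialOrder] l) ∧
      f.coeff (BMS.LP T f) ≠ 0 ∧
      U l = -(f.coeff (BMS.LP T f))⁻¹ *
        ∑ m ∈ f.support.erase (BMS.LP T f), f.coeff m * U (m + l - BMS.LP T f) := by
  have hsum := fun n => (congrFun hU n).trans (BMS.syndromeTable_eq_sum α τ e n)
  have h2t : ∀ i, 2 * t ≤ r i := fun i => by have := ht i; omega
  have htr : ∀ i, t < r i := fun i => by have := h2t i; omega
  have hrange : BMS.InRange r t l T := by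
    have h0 := htr 0
    have h1 := htr 1
    cases T <;> simp only [BMS.InRange] <;> omega
  have hF' : (∀ f ∈ F, f ≠ 0) ∧ BMS.footprint T F ⊆ BMS.footprintAll T U ∧
      ∀ f ∈ F, BMS.LP T f ≤ l → f ∈ BMS.generatingAll T U l := by
    rcases hF with ⟨G, hrun⟩ | hmin
    · have hinv := hrun.invariant hsum hw h2t htr hrange
      exact ⟨hinv.ne_zero, hinv.subset, fun f hf _ => hinv.valid f hf⟩
    · refine ⟨?_, hmin.footprint_subset, ?_⟩ <;>
        obtain ⟨d, f, rfl, hf, -⟩ := hmin.1 <;> rintro _ ⟨i, rfl⟩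
      · exact (hf i).1
      · intro hle
        refine BMS.mem_generatingAll_of_mem_generating hsum htr hrange ?_ (hf i).2
        have h1 := hle 1
        have h2 := h2t 1
        omega
  obtain ⟨hne, hsub, hval⟩ := hF'
  -- `l₁, l₂ ≥ 2` gives `l₁ l₂ ≥ l₁ + l₂ = t`, so half of the rectangle below `l` exceeds `t`
  have hcount : 2 * t < (l 0 + 1) * (l 1 + 1) := by
    have := Nat.mul_le_mul (show 1 ≤ l 0 - 1 by omega) (show 1 ≤ l 1 - 1 by omega)
    zify [hl0.le, hl1.le] at this hl ⊢
    nlinarith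
  obtain ⟨f, hf, hle, h0⟩ := BMS.exists_recur_eq_zero
    (fun S hS => (BMS.card_le_of_subset_footprintAll T hsum hS).trans hw) hcount hsub hval
  exact ⟨f, hf, hle, h0, fun m hm => BMS.add_tsub_LP_lt hle hm,
    T.toMonomialOrder.coeff_degree_ne_zero_iff.mpr (hne f hf),
    BMS.apply_eq_of_recur_eq_zero (hne f hf) hle h0⟩
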